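/- Let $\mathsf k$ be a field, $S=\mathsf k[x_1,\dots,x_n]$, and let $I\subseteq S$ be a monomial ideal minimally generated by monomials $\mathbf m_1,\dots,\mathbf m_t$. The Taylor complex $\mathbb T$ of $I$ is the full simplex with vertices $\mathbf m_1,\dots,\mathbf m_t$, each face $\sigma$ being labelled by $\mathbf m_\sigma=\mathrm{lcm}(\sigma)$, the least common multiple of its vertices. Let $\Delta$ be a subcomplex of $\mathbb T$ (a simplicial complex, the empty set being counted as a face of it). Let $N$ be the set of inclusion-minimal nonfaces of $\Delta$, equipped with a total order $\succcurlyeq$, let $Y$ be the set of all nonfaces of $\Delta$, and for $\sigma\in N$ let $$Y_\succcurlyeq(\sigma)=\{\gamma\in Y : \sigma=\max\nolimits_\succcurlyeq\{\tau\in N:\tau\subseteq\gamma\}\},$$ so that the sets $Y_\succcurlyeq(\sigma)$, $\sigma\in N$, partition $Y$. Assume that $\omega\colon N\to\{\mathbf m_1,\dots,\mathbf m_t\}$ is a function such that for each $\sigma\in N$: 1. $\omega(\sigma)\notin\sigma$; 2. $\omega(\sigma)\mid\mathrm{lcm}(\sigma)$; 3. if $\tau\in Y_\succcurlyeq(\sigma)$,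 then $\tau\cup\{\omega(\sigma)\}\in Y_\succcurlyeq(\sigma)$. Then $\Delta$ supports a free resolution of $I$. That is, let $F_i$ be the free $S$-module with basis $e_\sigma$ indexed by the $i$-dimensional faces $\sigma$ of $\Delta$ (those with $i+1$ vertices), and let $$d(e_\sigma)=\sum_{v\in\sigma}\pm\frac{\mathbf m_\sigma}{\mathbf m_{\sigma\setminus\{v\}}}\,e_{\sigma\setminus\{v\}},\qquad \varepsilon(e_{\{v\}})=\mathbf m_{\{v\}},$$ where the signs are those of the simplicial boundary map, $(-1)^p$ if exactly $p$ vertices of $\sigma$ precede $v$. Then the sequence $\cdots\to F_2\xrightarrow{d}F_1\xrightarrow{d}F_0\xrightarrow{\varepsilon}I\to0$ is exact, and hence a finite free resolution of $I$. -/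

import Mathlib

noncomputable section

namespace MonomialResolution

open MvPolynomial

/-! ### Monomial ideals and the labels of the Taylor complex

A monomial of `S = k[x₁, …, xₙ]` is given by its exponent vector `a : Fin n →₀ ℕ`; the corresponding
polynomial is `monomial a 1`. A finite list of monomials is a map `m : Fin t → (Fin n →₀ ℕ)`. -/

/-- The ideal `I` of `k[x₁, …, xₙ]` is minimally generated by the monomials `m₁, …, mₜ`: they
generate `I`, and no `mᵢ` lies in the ideal generated by the others. -/
def IsMinimallyGeneratedBy {k : Type*} [Field k] {n t : ℕ}
    (I : Ideal (MvPolynomial (Fin n) k)) (m : Fin t → (Fin n →₀ ℕ)) : Prop :=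
  I = Ideal.span (Set.range fun i => monomial (m i) (1 : k)) ∧
    ∀ i, monomial (m i) (1 : k) ∉
      Ideal.span ((fun j => monomial (m j) (1 : k)) '' {j | j ≠ i})

/-- The label of a set `σ` of generators: (the exponent vector of) the least common multiple of the
monomials `mᵢ`, `i ∈ σ`, that is, the coordinatewise maximum of the exponents. -/
def label {n t : ℕ} (m : Fin t → (Fin n →₀ ℕ)) (σ : Finset (Fin t)) : Fin n →₀ ℕ :=
  σ.sup m

/-! ### Subcomplexes of the Taylor complex

The Taylor complex of an ideal with `t` minimal generators is the full simplex on the vertex set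
`Fin t`, with faces labelled by `label m`. A subcomplex of it is a simplicial complex
`Δ : PreAbstractSimplicialComplex (Fin t)`. Mathlib lists the nonempty faces only: the empty set is
always understood to be a face, so that the nonfaces of `Δ` are the nonempty sets not in `Δ`. -/

/-- `γ` is a nonface of `Δ`. -/
def IsNonface {t : ℕ} (Δ : PreAbstractSimplicialComplex (Fin t)) (γ : Finset (Fin t)) : Prop :=
  γ.Nonempty ∧ γ ∉ Δ

/-- The set `N` of nonfaces of `Δ` that are minimal with respect to inclusion. It is a structure,
so that it carries no order of its own. -/
@[ext]
structure MinNonface {t : ℕ} (Δ : PreAbstractSimplicialComplex (Fin t)) where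
  /-- the underlying set of vertices -/
  verts : Finset (Fin t)
  /-- it is an inclusion-minimal nonface -/
  isMinimal : Minimal (IsNonface Δ) verts

/-- The class `Y(σ)` of a minimal nonface `σ`, for a total order on the set `N` of minimal nonfaces:
all nonfaces `γ` such that `σ` is the largest element of `{τ ∈ N | τ ⊆ γ}`. -/
def nonfaceClass {t : ℕ} {Δ : PreAbstractSimplicialComplex (Fin t)} [LinearOrder (MinNonface Δ)]
    (σ : MinNonface Δ) : Set (Finset (Fin t)) :=
  {γ | IsNonface Δ γ ∧ IsGreatest {τ : MinNonface Δ | τ.verts ⊆ γ} σ}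

/-! ### The homogenized simplicial chain complex -/

/-- The faces of `Δ` of dimension `i`, i.e. with `i + 1` vertices. -/
abbrev Face {t : ℕ} (Δ : PreAbstractSimplicialComplex (Fin t)) (i : ℕ) : Type :=
  {σ : Finset (Fin t) // σ ∈ Δ ∧ σ.card = i + 1}

/-- The facet `σ ∖ {v}` of an `(i + 1)`-dimensional face `σ`, for a vertex `v` of `σ`. -/
def Face.erase {t : ℕ} {Δ : PreAbstractSimplicialComplex (Fin t)} {i : ℕ}
    (σ : Face Δ (i + 1)) (v : Fin t) (hv : v ∈ σ.1) : Face Δ i :=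
  ⟨σ.1.erase v, by
    have hc : (σ.1.erase v).card = i + 1 := by
      rw [Finset.card_erase_of_mem hv, σ.2.2]; rfl
    refine ⟨(Δ.isRelLowerSet_faces σ.2.1).2 (Finset.erase_subset _ _) ?_, hc⟩
    exact Finset.card_pos.mp (by omega)⟩

/-- The `i`-th module of the homogenized chain complex of `Δ`: the free `S`-module on the
`i`-dimensional faces of `Δ`, where `S = k[x₁, …, xₙ]`. -/
abbrev Chains (k : Type*) [Field k] (n : ℕ) {t : ℕ} (Δ : PreAbstractSimplicialComplex (Fin t))
    (i : ℕ) : Type _ :=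
  Face Δ i →₀ MvPolynomial (Fin n) k

/-- The homogenized simplicial boundary map
`e_σ ↦ ∑_{v ∈ σ} ± (m_σ / m_{σ ∖ v}) e_{σ ∖ v}`, where the sign is `(-1) ^ p` if `v` is preceded by
exactly `p` vertices of `σ`. The label of `σ ∖ v` divides the label of `σ`, so the difference of
exponent vectors is the exponent vector of the quotient. -/
def boundary (k : Type*) [Field k] {n t : ℕ} (m : Fin t → (Fin n →₀ ℕ))
    (Δ : PreAbstractSimplicialComplex (Fin t)) (i : ℕ) :
    Chains k n Δ (i + 1) →ₗ[MvPolynomial (Fin n) k] Chains k n Δ i :=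
  Finsupp.linearCombination (MvPolynomial (Fin n) k) fun σ : Face Δ (i + 1) =>
    ∑ v ∈ σ.1.attach,
      Finsupp.single (σ.erase v.1 v.2)
        ((-1) ^ (σ.1.filter (· < v.1)).card *
          monomial (label m σ.1 - label m (σ.1.erase v.1)) (1 : k))

/-- The augmentation `e_{v} ↦ m_v` from the free module on the vertices of `Δ` to `S`. -/
def augmentation (k : Type*) [Field k] {n t : ℕ} (m : Fin t → (Fin n →₀ ℕ))
    (Δ : PreAbstractSimplicialComplex (Fin t)) :
    Chains k n Δ 0 →ₗ[MvPolynomial (Fin n) k] MvPolynomial (Fin n) k :=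
  Finsupp.linearCombination (MvPolynomial (Fin n) k) fun σ : Face Δ 0 =>
    monomial (label m σ.1) (1 : k)

/-- The sequence `⋯ → F 2 → F 1 → F 0 → I → 0`, with maps `d i : F (i + 1) → F i` and
`ε : F 0 → I ⊆ S`, is a (finite) free resolution of the ideal `I` of `S`: the modules are free of
finite rank and eventually zero, the image of `ε` is `I`, and the sequence is exact (in particular a
complex) at every `F i`. -/
def IsFreeResolution {S : Type*} [CommRing S] (I : Ideal S) (F : ℕ → Type*)
    [∀ i, AddCommGroup (F i)] [∀ i, Module S (F i)]
    (d : ∀ i, F (i + 1) →ₗ[S] F i) (ε : F 0 →ₗ[S] S) : Prop :=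
  (∀ i, Module.Free S (F i) ∧ Module.Finite S (F i)) ∧
  (∃ p, ∀ i, p ≤ i → Subsingleton (F i)) ∧
  LinearMap.range ε = I ∧
  Function.Exact (d 0) ε ∧
  ∀ i, Function.Exact (d (i + 1)) (d i)

/-- The subcomplex `Δ` of the Taylor complex of `m₁, …, mₜ` supports a free resolution of `I`: its
homogenized simplicial chain complex, augmented by `e_{v} ↦ m_v`, is a free resolution of `I`. -/
def SupportsFreeResolution {k : Type*} [Field k] {n t : ℕ} (m : Fin t → (Fin n →₀ ℕ))
    (Δ : PreAbstractSimplicialComplex (Fin t)) (I : Ideal (MvPolynomial (Fin n) k)) : Prop :=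
  IsFreeResolution I (Chains k n Δ) (boundary k m Δ) (augmentation k m Δ)

end MonomialResolution

end

/-! All maps are homogeneous for the multigrading, and the strand of degree `b` is the augmented
chain complex over `k` of the faces of `Δ` whose label divides `b`. Exactness thus reduces to
acyclicity of these subcomplexes (`exists_boundary_eq_of_cycle`).

A nonzero cycle there bounds a cone in the Taylor complex, with apex a vertex whose label divides
`b`. This filling may use nonfaces, which `exists_boundary_eq_of_nonfaceClass` clears class by
class, from the largest minimal nonface down: on the class of `σ`, subtract the boundary of the cone
with apex `ω σ` over the part of the chain in that class. Condition 3 keeps this cone in the class,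
so larger classes stay clear; condition 1 makes what is left on the class vanish; condition 2 keeps
the labels below `b`.

Minimality of the generators enters only in showing that every generator is a vertex of `Δ`. -/

namespace MonomialResolution

open MvPolynomial

variable {k : Type*} [Field k] {n t : ℕ}

/-! ### The augmented chain complex of the full simplex over a field -/

/-- The sign of the vertex `v` relative to `τ`: `(-1) ^ p` if `v` is preceded by `p` vertices. -/
def vertexSign (k : Type*) [Field k] {t : ℕ} (v : Fin t) (τ : Finset (Fin t)) : k :=
  (-1) ^ (τ.filter (· < v)).card

lemma vertexSign_mul_self (v : Fin t) (τ : Finset (Fin t)) :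
    vertexSign k v τ * vertexSign k v τ = 1 := by
  rw [vertexSign, ← mul_pow]; simp

lemma vertexSign_insert {x : Fin t} {τ : Finset (Fin t)} (hx : x ∉ τ) (v : Fin t) :
    vertexSign k v (insert x τ) = (if x < v then -1 else 1) * vertexSign k v τ := by
  unfold vertexSign
  rw [Finset.filter_insert]
  split_ifs
  · rw [Finset.card_insert_of_notMem (by simp [hx]), pow_succ']
  · simp

lemma vertexSign_insert_self {v : Fin t} {τ : Finset (Fin t)} (hv : v ∉ τ) :
    vertexSign k v (insert v τ) = vertexSign k v τ := by
  simp [vertexSign_insert hv]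

/-- The augmented simplicial boundary map of the full simplex, on chains seen as functions. -/
noncomputable def simplexBoundary (k : Type*) [Field k] (t : ℕ) :
    (Finset (Fin t) → k) →ₗ[k] (Finset (Fin t) → k) where
  toFun c τ := ∑ v ∈ τᶜ, vertexSign k v τ * c (insert v τ)
  map_add' c c' := by ext τ; simp [mul_add, Finset.sum_add_distrib]
  map_smul' r c := by ext τ; simp [Finset.mul_sum, mul_left_comm]

lemma simplexBoundary_apply (c : Finset (Fin t) → k) (τ : Finset (Fin t)) :
    simplexBoundary k t c τ = ∑ v ∈ τᶜ, vertexSign k v τ * c (insert v τ) := rfl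

/-- The cone with apex `v`, a contracting homotopy of the full simplex. -/
noncomputable def cone (k : Type*) [Field k] {t : ℕ} (v : Fin t) :
    (Finset (Fin t) → k) →ₗ[k] (Finset (Fin t) → k) where
  toFun c τ := if v ∈ τ then vertexSign k v τ * c (τ.erase v) else 0
  map_add' c c' := by ext τ; by_cases h : v ∈ τ <;> simp [h, mul_add]
  map_smul' r c := by ext τ; by_cases h : v ∈ τ <;> simp [h, mul_left_comm]

lemma cone_apply (v : Fin t) (c : Finset (Fin t) → k) (τ : Finset (Fin t)) :
    cone k v c τ = if v ∈ τ then vertexSign k v τ * c (τ.erase v) else 0 := rfl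

/-- At a face `insert v ρ`, the term of `v` in the boundary at `ρ` returns `c`; the remaining terms
cancel, since exchanging the order of two vertices flips the sign. -/
lemma simplexBoundary_cone (v : Fin t) (c : Finset (Fin t) → k) :
    simplexBoundary k t (cone k v c) = c - cone k v (simplexBoundary k t c) := by
  ext τ
  rw [Pi.sub_apply, simplexBoundary_apply, cone_apply]
  by_cases hv : v ∈ τ
  · obtain ⟨ρ, hρ, rfl⟩ : ∃ ρ, v ∉ ρ ∧ insert v ρ = τ :=
      ⟨τ.erase v, Finset.notMem_erase _ _, Finset.insert_erase hv⟩
    have hc : ρᶜ = insert v (insert v ρ)ᶜ := by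
      ext x; by_cases hx : x = v <;> simp [hx, hρ]
    rw [if_pos hv, Finset.erase_insert hρ, simplexBoundary_apply, hc,
      Finset.sum_insert (by simp), mul_add, ← mul_assoc, vertexSign_insert_self hρ,
      vertexSign_mul_self, one_mul, sub_add_cancel_left, Finset.mul_sum, ← Finset.sum_neg_distrib]
    refine Finset.sum_congr rfl fun x hx => ?_
    obtain ⟨hxv, hxρ⟩ : x ≠ v ∧ x ∉ ρ := by simpa using hx
    rw [cone_apply, if_pos (by simp), Finset.insert_comm,
      Finset.erase_insert (by simp [hρ, hxv.symm]),
      vertexSign_insert hρ, vertexSign_insert (by simp [hρ, hxv.symm]), vertexSign_insert hxρ]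
    rcases lt_or_gt_of_ne hxv with h | h <;> simp [h, h.not_gt] <;> ring
  · rw [if_neg hv, sub_zero, Finset.sum_eq_single v]
    · rw [cone_apply, if_pos (by simp), Finset.erase_insert hv, vertexSign_insert_self hv,
        ← mul_assoc, vertexSign_mul_self, one_mul]
    · intro x _ hx
      rw [cone_apply, if_neg (by simp [hv, hx.symm]), mul_zero]
    · simp [hv]

lemma simplexBoundary_single (σ : Finset (Fin t)) (r : k) :
    simplexBoundary k t (Pi.single σ r) =
      ∑ v ∈ σ, Pi.single (σ.erase v) (vertexSign k v σ * r) := by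
  ext τ
  rw [simplexBoundary_apply, Finset.sum_apply,
    ← Finset.sum_filter_of_ne (p := fun v => insert v τ = σ),
    ← Finset.sum_filter_of_ne (s := σ) (p := fun v => σ.erase v = τ)]
  · have : τᶜ.filter (fun v => insert v τ = σ) = σ.filter (fun v => σ.erase v = τ) := by
      ext v
      simp only [Finset.mem_filter, Finset.mem_compl]
      constructor
      · rintro ⟨h, rfl⟩; simp [h]
      · rintro ⟨h, rfl⟩; simp [h]
    rw [← this]
    refine Finset.sum_congr rfl fun v hv => ?_
    obtain ⟨h, rfl⟩ : v ∉ τ ∧ insert v τ = σ := by simpa using hv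
    rw [Finset.erase_insert h, Pi.single_eq_same, Pi.single_eq_same, vertexSign_insert_self h]
  · intro v _ h
    by_contra hne
    exact h (by rw [Pi.single_eq_of_ne (Ne.symm hne)])
  · intro v _ h
    by_contra hne
    exact h (by rw [Pi.single_eq_of_ne hne, mul_zero])

lemma cone_single {v : Fin t} {τ : Finset (Fin t)} (hv : v ∉ τ) (r : k) :
    cone k v (Pi.single τ r) = Pi.single (insert v τ) (vertexSign k v τ * r) := by
  ext ρ
  rw [cone_apply]
  by_cases h : ρ = insert v τ
  · subst h; simp [Finset.erase_insert hv, vertexSign_insert_self hv]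
  · rw [Pi.single_eq_of_ne h]
    split_ifs with hρ
    · rw [Pi.single_eq_of_ne, mul_zero]
      rintro rfl
      exact h (Finset.insert_erase hρ).symm
    · rfl

/-- A nonempty simplex is a cone over a facet, and the homotopy identity, used twice, moves the
squared boundary past the cone. -/
lemma simplexBoundary_simplexBoundary_single (σ : Finset (Fin t)) (r : k) :
    simplexBoundary k t (simplexBoundary k t (Pi.single σ r)) = 0 := by
  induction σ using Finset.induction_on generalizing r with
  | empty => simp [simplexBoundary_single]
  | insert v τ hv ih =>
    have h : (Pi.single (insert v τ) r : Finset (Fin t) → k) =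
        cone k v (Pi.single τ (vertexSign k v τ * r)) := by
      rw [cone_single hv, ← mul_assoc, vertexSign_mul_self, one_mul]
    rw [h, simplexBoundary_cone, map_sub, simplexBoundary_cone, ih, map_zero, sub_zero, sub_self]

lemma simplexBoundary_simplexBoundary (c : Finset (Fin t) → k) :
    simplexBoundary k t (simplexBoundary k t c) = 0 := by
  have h : simplexBoundary k t ∘ₗ simplexBoundary k t = 0 :=
    LinearMap.pi_ext fun σ r => simplexBoundary_simplexBoundary_single σ r
  exact LinearMap.congr_fun h c

/-! ### Minimal nonfaces -/

section Nonfaces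

variable {Δ : PreAbstractSimplicialComplex (Fin t)}

instance : Finite (MinNonface Δ) :=
  Finite.of_injective MinNonface.verts fun _ _ => MinNonface.ext

lemma IsNonface.mono {γ δ : Finset (Fin t)} (hγ : IsNonface Δ γ) (h : γ ⊆ δ) : IsNonface Δ δ :=
  ⟨hγ.1.mono h, fun hδ => hγ.2 ((Δ.isRelLowerSet_faces hδ).2 h hγ.1)⟩

variable [LinearOrder (MinNonface Δ)]

lemma IsNonface.exists_mem_nonfaceClass {γ : Finset (Fin t)} (hγ : IsNonface Δ γ) :
    ∃ σ : MinNonface Δ, γ ∈ nonfaceClass σ := by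
  obtain ⟨τ, hτγ, hτ⟩ := exists_minimal_le_of_wellFoundedLT (IsNonface Δ) γ hγ
  obtain ⟨σ, hσ⟩ := Set.exists_max_image {τ : MinNonface Δ | τ.verts ⊆ γ} id (Set.toFinite _)
    ⟨⟨τ, hτ⟩, hτγ⟩
  exact ⟨σ, hγ, hσ.1, fun τ hτ => hσ.2 τ hτ⟩

lemma nonfaceClass_le_of_subset {σ τ : MinNonface Δ} {γ δ : Finset (Fin t)}
    (hγ : γ ∈ nonfaceClass σ) (hδ : δ ∈ nonfaceClass τ) (h : γ ⊆ δ) : σ ≤ τ :=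
  hδ.2.2 (hγ.2.1.trans h)

lemma erase_mem_nonfaceClass {σ : MinNonface Δ} {γ : Finset (Fin t)} (hγ : γ ∈ nonfaceClass σ)
    {v : Fin t} (hv : v ∉ σ.verts) : γ.erase v ∈ nonfaceClass σ := by
  have h : σ.verts ⊆ γ.erase v := Finset.subset_erase.2 ⟨hγ.2.1, hv⟩
  exact ⟨σ.isMinimal.prop.mono h, h, fun τ hτ => hγ.2.2 (hτ.trans (Finset.erase_subset _ _))⟩

/-- If the class of each minimal nonface `σ` is closed under adding the vertex `ω σ`, then a chain
whose boundary lies in `Δ` can be moved into `Δ` without changing its boundary. -/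
lemma exists_boundary_eq_of_nonfaceClass (ω : MinNonface Δ → Fin t)
    (hω_notMem : ∀ σ, ω σ ∉ σ.verts)
    (hω_class : ∀ σ, ∀ τ ∈ nonfaceClass σ, insert (ω σ) τ ∈ nonfaceClass σ)
    (A : ℕ → Set (Finset (Fin t)))
    (hA_insert : ∀ j σ, ∀ γ ∈ nonfaceClass σ, γ ∈ A j → ω σ ∉ γ → insert (ω σ) γ ∈ A (j + 1))
    (hA_erase : ∀ j, ∀ γ ∈ A (j + 1), ∀ v ∈ γ, γ.erase v ∈ A j)
    (j : ℕ) (c : Finset (Fin t) → k) (hcA : ∀ γ ∉ A j, c γ = 0)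
    (hc : ∀ γ, IsNonface Δ γ → simplexBoundary k t c γ = 0) :
    ∃ c' : Finset (Fin t) → k, (∀ γ ∉ A j, c' γ = 0) ∧ (∀ γ, IsNonface Δ γ → c' γ = 0) ∧
      simplexBoundary k t c' = simplexBoundary k t c := by
  classical
  have := Fintype.ofFinite (MinNonface Δ)
  -- `s` is the lower set of classes still to be cleared; its maximum is treated first.
  suffices H : ∀ s : Finset (MinNonface Δ), (∀ a ∈ s, ∀ b < a, b ∈ s) →
      ∀ c : Finset (Fin t) → k, (∀ γ ∉ A j, c γ = 0) →
      (∀ γ, IsNonface Δ γ → simplexBoundary k t c γ = 0) →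
      (∀ σ ∉ s, ∀ γ ∈ nonfaceClass σ, c γ = 0) →
      ∃ c' : Finset (Fin t) → k, (∀ γ ∉ A j, c' γ = 0) ∧ (∀ γ, IsNonface Δ γ → c' γ = 0) ∧
        simplexBoundary k t c' = simplexBoundary k t c from
    H Finset.univ (by simp) c hcA hc (by simp)
  intro s
  induction s using Finset.induction_on_max with
  | empty =>
    intro _ c hcA _ hs
    refine ⟨c, hcA, fun γ hγ => ?_, rfl⟩
    obtain ⟨σ, hσ⟩ := hγ.exists_mem_nonfaceClass
    exact hs σ (by simp) γ hσ
  | insert a s ha ih =>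
    intro hs c hcA hc hcs
    have hgt : ∀ τ, τ ∉ insert a s → a < τ := fun τ hτ => by
      by_contra! h
      rcases h.eq_or_lt with rfl | h
      · exact hτ (by simp)
      · exact hτ (hs a (by simp) τ h)
    set e : Finset (Fin t) → k := fun γ => if γ ∈ nonfaceClass a then c γ else 0 with he
    set p := cone k (ω a) e with hp
    have hp_class : ∀ γ ∉ nonfaceClass a, p γ = 0 := fun γ hγ => by
      rw [hp, cone_apply]
      split_ifs with h
      · have : γ.erase (ω a) ∉ nonfaceClass a := fun h' =>
          hγ (by simpa [Finset.insert_erase h] using hω_class a _ h')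
        simp [he, this]
      · rfl
    have hp_A : ∀ γ ∉ A (j + 1), p γ = 0 := fun γ hγ => by
      rw [hp, cone_apply]
      split_ifs with h
      · by_cases h1 : γ.erase (ω a) ∈ nonfaceClass a
        · have h2 : γ.erase (ω a) ∉ A j := fun h' =>
            hγ (by simpa [Finset.insert_erase h] using
              hA_insert j a _ h1 h' (Finset.notMem_erase _ _))
          simp [he, hcA _ h2]
        · simp [he, h1]
      · rfl
    have hbd : simplexBoundary k t (c - simplexBoundary k t p) = simplexBoundary k t c := by
      rw [map_sub, simplexBoundary_simplexBoundary, sub_zero]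
    have hA' : ∀ γ ∉ A j, (c - simplexBoundary k t p) γ = 0 := fun γ hγ => by
      rw [Pi.sub_apply, hcA γ hγ, simplexBoundary_apply, Finset.sum_eq_zero, sub_zero]
      intro v hv
      rw [hp_A, mul_zero]
      intro h
      have h' := hA_erase j _ h v (by simp)
      rw [Finset.erase_insert (Finset.mem_compl.1 hv)] at h'
      exact hγ h'
    have hs' : ∀ τ ∉ s, ∀ γ ∈ nonfaceClass τ, (c - simplexBoundary k t p) γ = 0 := by
      intro τ hτ γ hγ
      by_cases hτa : τ = a
      · subst hτa
        rw [hp, simplexBoundary_cone, Pi.sub_apply, Pi.sub_apply]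
        have : e γ = c γ := by simp [he, hγ]
        rw [this, sub_sub_cancel, cone_apply]
        split_ifs with h
        -- The value left at `γ` is, up to sign, the boundary of `e` at `γ.erase (ω τ)`. It equals
        -- that of `c`, which is zero: cofaces outside the class lie in larger classes, where `c`
        -- already vanishes.
        · have hδ := erase_mem_nonfaceClass hγ (hω_notMem τ)
          rw [← mul_zero (vertexSign k (ω τ) γ), ← hc _ hδ.1, simplexBoundary_apply,
            simplexBoundary_apply]
          congr 1
          refine Finset.sum_congr rfl fun v _ => ?_
          congr 1
          simp only [he]
          split_ifs with hv
          · rfl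
          · obtain ⟨ρ, hρ⟩ := (hδ.1.mono (Finset.subset_insert v _)).exists_mem_nonfaceClass
            refine (hcs ρ ?_ _ hρ).symm
            intro hmem
            have hle := nonfaceClass_le_of_subset hδ hρ (Finset.subset_insert v _)
            rcases Finset.mem_insert.1 hmem with rfl | hmem
            · exact hv hρ
            · exact (ha ρ hmem).not_ge hle
        · rfl
      -- A coface of `γ` cannot lie in the smaller class of `a`, so the correction does not touch
      -- classes already cleared.
      · have hτ' : τ ∉ insert a s := by simp [hτa, hτ]
        rw [Pi.sub_apply, hcs τ hτ' γ hγ, simplexBoundary_apply, Finset.sum_eq_zero, sub_zero]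
        intro v _
        rw [hp_class, mul_zero]
        intro h
        exact (hgt τ hτ').not_ge (nonfaceClass_le_of_subset hγ h (Finset.subset_insert v _))
    obtain ⟨c', h1, h2, h3⟩ := ih
      (fun x hx b hb => (Finset.mem_insert.1 (hs x (by simp [hx]) b hb)).resolve_left
        (hb.trans (ha x hx)).ne) (c - simplexBoundary k t p) hA' (by rwa [hbd]) hs'
    exact ⟨c', h1, h2, h3.trans hbd⟩

end Nonfaces

/-! ### Labels -/

lemma label_mono (m : Fin t → (Fin n →₀ ℕ)) {σ τ : Finset (Fin t)} (h : σ ⊆ τ) :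
    label m σ ≤ label m τ := Finset.sup_mono h

lemma label_insert (m : Fin t → (Fin n →₀ ℕ)) (v : Fin t) (σ : Finset (Fin t)) :
    label m (insert v σ) = m v ⊔ label m σ := Finset.sup_insert

/-- The faces of the Taylor complex with `j` vertices whose label divides the monomial `b`. -/
def taylorFaces (m : Fin t → (Fin n →₀ ℕ)) (b : Fin n →₀ ℕ) (j : ℕ) : Set (Finset (Fin t)) :=
  {γ | γ.card = j ∧ label m γ ≤ b}

/-- Acyclicity of the subcomplex of `Δ` of faces whose label divides `b`. -/
lemma exists_boundary_eq_of_cycle {Δ : PreAbstractSimplicialComplex (Fin t)}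
    [LinearOrder (MinNonface Δ)] (m : Fin t → (Fin n →₀ ℕ)) (ω : MinNonface Δ → Fin t)
    (hω_notMem : ∀ σ, ω σ ∉ σ.verts) (hω_le : ∀ σ, m (ω σ) ≤ label m σ.verts)
    (hω_class : ∀ σ, ∀ τ ∈ nonfaceClass σ, insert (ω σ) τ ∈ nonfaceClass σ)
    (b : Fin n →₀ ℕ) (i : ℕ) (c : Finset (Fin t) → k)
    (hc : ∀ γ, c γ ≠ 0 → γ ∈ Δ ∧ γ ∈ taylorFaces m b (i + 1))
    (hbd : simplexBoundary k t c = 0) :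
    ∃ w : Finset (Fin t) → k, (∀ γ, w γ ≠ 0 → γ ∈ Δ ∧ γ ∈ taylorFaces m b (i + 2)) ∧
      simplexBoundary k t w = c := by
  -- Without a face in the support of `c`, there may be no vertex dividing `b` to serve as apex.
  by_cases hc0 : c = 0
  · exact ⟨0, by simp, by simp [hc0]⟩
  obtain ⟨γ₀, hγ₀⟩ := Function.ne_iff.1 hc0
  obtain ⟨v, hv⟩ := Finset.card_pos.1 (by rw [(hc γ₀ hγ₀).2.1]; omega : 0 < γ₀.card)
  have hvb : m v ≤ b := (Finset.le_sup hv).trans (hc γ₀ hγ₀).2.2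
  have hw : simplexBoundary k t (cone k v c) = c := by
    rw [simplexBoundary_cone, hbd, map_zero, sub_zero]
  have H := exists_boundary_eq_of_nonfaceClass ω hω_notMem hω_class
    (taylorFaces m b) ?_ ?_ (i + 2) (cone k v c) ?_ ?_
  · obtain ⟨w, h1, h2, h3⟩ := H
    refine ⟨w, fun γ hγ => ?_, h3.trans hw⟩
    have hA : γ ∈ taylorFaces m b (i + 2) := by_contra fun h => hγ (h1 γ h)
    refine ⟨by_contra fun h => hγ (h2 γ ⟨?_, h⟩), hA⟩
    exact Finset.card_pos.1 (by rw [hA.1]; omega)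
  · rintro j σ γ hγ ⟨hj, hb⟩ hωγ
    refine ⟨by rw [Finset.card_insert_of_notMem hωγ, hj], ?_⟩
    rw [label_insert]
    exact sup_le ((hω_le σ).trans ((label_mono m hγ.2.1).trans hb)) hb
  · rintro j γ ⟨hj, hb⟩ x hx
    exact ⟨by rw [Finset.card_erase_of_mem hx, hj]; rfl,
      (label_mono m (Finset.erase_subset _ _)).trans hb⟩
  · intro γ hγ
    rw [cone_apply]
    split_ifs with h
    · by_contra hne
      obtain ⟨_, hcard, hb⟩ := hc _ (right_ne_zero_of_mul hne)
      refine hγ ⟨?_, ?_⟩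
      · rw [← Finset.card_erase_add_one h, hcard]
      · rw [← Finset.insert_erase h, label_insert]
        exact sup_le hvb hb
    · rfl
  · intro γ hγ
    rw [hw]
    by_contra h
    exact hγ.2 (hc γ h).1

/-! ### Multigraded strands of the homogenized chain complex -/

section Strand

variable (m : Fin t → (Fin n →₀ ℕ)) {Δ : PreAbstractSimplicialComplex (Fin t)}

open Classical in
/-- The component of multidegree `b` of a homogenized chain, as a chain over the field. -/
noncomputable def strand (b : Fin n →₀ ℕ) (i : ℕ) :
    Chains k n Δ i →+ (Finset (Fin t) → k) where
  toFun z γ := if h : γ ∈ Δ ∧ γ.card = i + 1 then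
    (if label m γ ≤ b then coeff (b - label m γ) (z ⟨γ, h⟩) else 0) else 0
  map_zero' := by ext; simp
  map_add' z z' := by ext γ; simp only [Pi.add_apply]; split_ifs <;> simp

lemma strand_apply_face (b : Fin n →₀ ℕ) {i : ℕ} (z : Chains k n Δ i) (σ : Face Δ i)
    (h : label m σ.1 ≤ b) : strand m b i z σ.1 = coeff (b - label m σ.1) (z σ) := by
  simp only [strand, AddMonoidHom.coe_mk, ZeroHom.coe_mk]
  rw [dif_pos σ.2, if_pos h]

lemma strand_ne_zero {b : Fin n →₀ ℕ} {i : ℕ} {z : Chains k n Δ i} {γ : Finset (Fin t)}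
    (h : strand m b i z γ ≠ 0) : γ ∈ Δ ∧ γ ∈ taylorFaces m b (i + 1) := by
  simp only [strand, AddMonoidHom.coe_mk, ZeroHom.coe_mk] at h
  split_ifs at h with h1 h2
  · exact ⟨h1.1, h1.2, h2⟩
  · exact absurd rfl h
  · exact absurd rfl h

lemma strand_single (b : Fin n →₀ ℕ) {i : ℕ} (σ : Face Δ i) (a : Fin n →₀ ℕ) (r : k) :
    strand m b i (Finsupp.single σ (monomial a r)) =
      if a + label m σ.1 = b then Pi.single σ.1 r else 0 := by
  classical
  ext γ
  by_cases hγ : γ = σ.1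
  · subst hγ
    by_cases hb : label m σ.1 ≤ b
    · rw [strand_apply_face m b _ σ hb, Finsupp.single_eq_same, coeff_monomial]
      have : a = b - label m σ.1 ↔ a + label m σ.1 = b :=
        ⟨fun h => by rw [h, tsub_add_cancel_of_le hb], fun h => by rw [← h, add_tsub_cancel_right]⟩
      simp only [this]
      split_ifs <;> simp
    · rw [if_neg (by rintro rfl; exact hb le_add_self)]
      by_contra h
      exact hb (strand_ne_zero m h).2.2
  · have : strand m b i (Finsupp.single σ (monomial a r)) γ = 0 := by
      simp only [strand, AddMonoidHom.coe_mk, ZeroHom.coe_mk]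
      split_ifs with h1 h2
      · rw [Finsupp.single_eq_of_ne (by rintro rfl; exact hγ rfl), coeff_zero]
      · rfl
      · rfl
    rw [this]
    split_ifs
    · rw [Pi.single_eq_of_ne hγ]
    · rfl

/-- The coefficient of `a` at `σ` is read off in degree `a + label m σ`. -/
lemma strand_ext {i : ℕ} {z z' : Chains k n Δ i}
    (h : ∀ b, strand m b i z = strand m b i z') : z = z' := by
  ext σ a
  have := congrFun (h (a + label m σ.1)) σ.1
  rwa [strand_apply_face m _ _ σ le_add_self, strand_apply_face m _ _ σ le_add_self,
    add_tsub_cancel_right] at this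

lemma finite_strand_ne_zero {i : ℕ} (z : Chains k n Δ i) : {b | strand m b i z ≠ 0}.Finite := by
  refine (Set.finite_iUnion fun σ : Face Δ i =>
    ((z σ).support.image (· + label m σ.1)).finite_toSet).subset fun b hb => ?_
  obtain ⟨γ, hγ⟩ := Function.ne_iff.1 hb
  obtain ⟨h1, h2, h3⟩ := strand_ne_zero m hγ
  rw [Pi.zero_apply, strand_apply_face m b z ⟨γ, h1, h2⟩ h3] at hγ
  rw [Set.mem_iUnion]
  refine ⟨⟨γ, h1, h2⟩, ?_⟩
  rw [Finset.mem_coe, Finset.mem_image]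
  exact ⟨b - label m γ, mem_support_iff.2 hγ, tsub_add_cancel_of_le h3⟩

lemma exists_strand_eq {i : ℕ} (w : (Fin n →₀ ℕ) → Finset (Fin t) → k)
    (hw : ∀ b γ, w b γ ≠ 0 → γ ∈ Δ ∧ γ ∈ taylorFaces m b (i + 1))
    (hfin : {b | w b ≠ 0}.Finite) :
    ∃ z : Chains k n Δ i, ∀ b, strand m b i z = w b := by
  classical
  refine ⟨∑ b ∈ hfin.toFinset, ∑ σ : Face Δ i,
    Finsupp.single σ (monomial (b - label m σ.1) (w b σ.1)), fun b => ?_⟩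
  have key : ∀ b' (σ : Face Δ i),
      strand m b i (Finsupp.single σ (monomial (b' - label m σ.1) (w b' σ.1))) =
        if b' = b then Pi.single σ.1 (w b' σ.1) else 0 := fun b' σ => by
    -- The truncated difference `b' - label m σ` is a true quotient only where `w b'` is nonzero.
    by_cases h0 : w b' σ.1 = 0
    · simp [h0]
    · rw [strand_single, tsub_add_cancel_of_le (hw _ _ h0).2.2]
  have key2 : ∑ σ : Face Δ i, Pi.single σ.1 (w b σ.1) = w b := by
    ext γ
    rw [Finset.sum_apply]
    by_cases h0 : w b γ = 0
    · rw [h0]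
      refine Finset.sum_eq_zero fun σ _ => ?_
      by_cases h : γ = σ.1
      · subst h; rw [Pi.single_eq_same, h0]
      · rw [Pi.single_eq_of_ne h]
    · obtain ⟨h1, h2, -⟩ := hw b γ h0
      rw [Finset.sum_eq_single ⟨γ, h1, h2⟩]
      · simp
      · intro σ _ hσ
        rw [Pi.single_eq_of_ne]
        rintro rfl
        exact hσ rfl
      · simp
  simp only [map_sum, key]
  rw [Finset.sum_comm]
  simp only [Finset.sum_ite_eq', Set.Finite.mem_toFinset, Set.mem_ofPred_eq]
  split_ifs with h
  · exact key2
  · rw [Finset.sum_const_zero, not_not.1 h]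

/-- Strands are additive but not `S`-linear, so checking basis vectors alone would not suffice. -/
lemma chains_addHom_ext {i : ℕ} {M : Type*} [AddCommMonoid M] {f g : Chains k n Δ i →+ M}
    (h : ∀ σ a r, f (Finsupp.single σ (monomial a r)) = g (Finsupp.single σ (monomial a r))) :
    f = g := by
  refine Finsupp.addHom_ext' fun σ => ?_
  refine DFunLike.ext _ _ fun p => ?_
  induction p using MvPolynomial.monomial_add_induction_on with
  | C r => exact h σ 0 r
  | monomial_add a r p _ _ hp => rw [map_add, map_add, hp]; congr 1; exact h σ a r

lemma strand_boundary (b : Fin n →₀ ℕ) (i : ℕ) (z : Chains k n Δ (i + 1)) :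
    strand m b i (boundary k m Δ i z) = simplexBoundary k t (strand m b (i + 1) z) := by
  suffices H : (strand m b i).comp (boundary k m Δ i).toAddMonoidHom =
      (simplexBoundary k t).toAddMonoidHom.comp (strand m b (i + 1)) from
    DFunLike.congr_fun H z
  refine chains_addHom_ext fun σ a r => ?_
  simp only [AddMonoidHom.comp_apply, LinearMap.toAddMonoidHom_coe, strand_single]
  have hterm : ∀ v : {x // x ∈ σ.1}, (monomial a r : MvPolynomial (Fin n) k) •
      Finsupp.single (σ.erase v.1 v.2) (((-1) ^ (σ.1.filter (· < v.1)).card *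
        monomial (label m σ.1 - label m (σ.1.erase v.1)) (1 : k) : MvPolynomial (Fin n) k)) =
      Finsupp.single (σ.erase v.1 v.2)
        (monomial (a + (label m σ.1 - label m (σ.1.erase v.1))) (vertexSign k v.1 σ.1 * r)) := by
    intro v
    rw [Finsupp.smul_single, smul_eq_mul]
    congr 1
    have : ((-1) ^ (σ.1.filter (· < v.1)).card : MvPolynomial (Fin n) k) =
        C (vertexSign k v.1 σ.1) := by simp [vertexSign]
    rw [this, C_mul_monomial, monomial_mul, mul_one, mul_comm r]
  rw [boundary, Finsupp.linearCombination_single, Finset.smul_sum]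
  simp only [hterm, map_sum, strand_single]
  have hlab : ∀ v : {x // x ∈ σ.1}, a + (label m σ.1 - label m (σ.1.erase v.1)) +
      label m (σ.erase v.1 v.2).1 = a + label m σ.1 := fun v => by
    rw [add_assoc]
    exact congrArg _ (tsub_add_cancel_of_le (label_mono m (Finset.erase_subset _ _)))
  simp only [hlab]
  split_ifs with h
  · rw [simplexBoundary_single, ← Finset.sum_attach σ.1]
    rfl
  · simp

/-- The empty face plays the role of the target of the augmentation. -/
lemma simplexBoundary_strand_zero (b : Fin n →₀ ℕ) (z : Chains k n Δ 0) :
    simplexBoundary k t (strand m b 0 z) =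
      Pi.single ∅ (coeff b (augmentation k m Δ z)) := by
  suffices H : (simplexBoundary k t).toAddMonoidHom.comp (strand m b 0) =
      (AddMonoidHom.single (fun _ : Finset (Fin t) => k) ∅).comp
        ((lcoeff k b).toAddMonoidHom.comp (augmentation k m Δ).toAddMonoidHom) from
    DFunLike.congr_fun H z
  refine chains_addHom_ext fun σ a r => ?_
  simp only [AddMonoidHom.comp_apply, LinearMap.toAddMonoidHom_coe, strand_single,
    AddMonoidHom.single_apply, lcoeff_apply]
  rw [augmentation, Finsupp.linearCombination_single, smul_eq_mul, monomial_mul, mul_one,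
    coeff_monomial]
  obtain ⟨v, hv⟩ := Finset.card_eq_one.1 σ.2.2
  split_ifs with h
  · rw [simplexBoundary_single, hv]
    simp [vertexSign, Finset.filter_singleton]
  · simp

end Strand

/-! ### Generators -/

lemma monomial_dvd_monomial_one_iff {a b : Fin n →₀ ℕ} :
    monomial a (1 : k) ∣ monomial b (1 : k) ↔ a ≤ b := by
  simp [monomial_dvd_monomial]

/-- No minimal nonface is a vertex, so that all generators are vertices of `Δ`. -/
lemma singleton_mem_of_isMinimallyGeneratedBy {I : Ideal (MvPolynomial (Fin n) k)}
    {m : Fin t → (Fin n →₀ ℕ)} (hI : IsMinimallyGeneratedBy I m)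
    {Δ : PreAbstractSimplicialComplex (Fin t)} (ω : MinNonface Δ → Fin t)
    (hω_notMem : ∀ σ, ω σ ∉ σ.verts)
    (hω_dvd : ∀ σ, monomial (m (ω σ)) (1 : k) ∣ monomial (label m σ.verts) (1 : k))
    (v : Fin t) : {v} ∈ Δ := by
  by_contra hv
  have hmin : Minimal (IsNonface Δ) {v} := by
    refine ⟨⟨by simp, hv⟩, fun γ hγ hle => ?_⟩
    rcases Finset.subset_singleton_iff.1 hle with rfl | rfl
    · exact absurd hγ.1 (by simp)
    · exact le_rfl
  -- The generator chosen by `ω` would be another one dividing `m v`, against minimality.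
  have hne : ω ⟨{v}, hmin⟩ ≠ v := by simpa using hω_notMem ⟨{v}, hmin⟩
  have hdvd := hω_dvd ⟨{v}, hmin⟩
  rw [label, Finset.sup_singleton] at hdvd
  exact hI.2 v (Ideal.mem_of_dvd _ hdvd (Ideal.subset_span ⟨_, hne, rfl⟩))

lemma range_augmentation (m : Fin t → (Fin n →₀ ℕ)) {Δ : PreAbstractSimplicialComplex (Fin t)}
    (hΔ : ∀ v, {v} ∈ Δ) :
    LinearMap.range (augmentation k m Δ) =
      Ideal.span (Set.range fun i => monomial (m i) (1 : k)) := by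
  rw [augmentation, Finsupp.range_linearCombination]
  refine congrArg (Submodule.span (MvPolynomial (Fin n) k)) (Set.ext fun p => ⟨?_, ?_⟩)
  · rintro ⟨σ, rfl⟩
    obtain ⟨v, hv⟩ := Finset.card_eq_one.1 σ.2.2
    exact ⟨v, by simp [hv, label]⟩
  · rintro ⟨v, rfl⟩
    exact ⟨⟨{v}, hΔ v, rfl⟩, by simp [label]⟩

/-- Fillings are chosen degree by degree and reassembled. As the simplex boundary is augmented, this
covers exactness at `F 0` too. -/
lemma exact_of_strand {i : ℕ} (m : Fin t → (Fin n →₀ ℕ)) {Δ : PreAbstractSimplicialComplex (Fin t)}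
    [LinearOrder (MinNonface Δ)] (ω : MinNonface Δ → Fin t)
    (hω_notMem : ∀ σ, ω σ ∉ σ.verts) (hω_le : ∀ σ, m (ω σ) ≤ label m σ.verts)
    (hω_class : ∀ σ, ∀ τ ∈ nonfaceClass σ, insert (ω σ) τ ∈ nonfaceClass σ)
    (z : Chains k n Δ i) (hz : ∀ b, simplexBoundary k t (strand m b i z) = 0) :
    z ∈ Set.range (boundary k m Δ i) := by
  -- The last clause leaves only finitely many nonzero fillings, so that they add up to a chain.
  have hex : ∀ b, ∃ w : Finset (Fin t) → k,
      (∀ γ, w γ ≠ 0 → γ ∈ Δ ∧ γ ∈ taylorFaces m b (i + 1 + 1)) ∧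
      simplexBoundary k t w = strand m b i z ∧ (strand m b i z = 0 → w = 0) := fun b => by
    by_cases h0 : strand m b i z = 0
    · exact ⟨0, by simp, by simp [h0], fun _ => rfl⟩
    · obtain ⟨w, hw, hwz⟩ := exists_boundary_eq_of_cycle m ω hω_notMem hω_le hω_class b i
        (strand m b i z) (fun _ => strand_ne_zero m) (hz b)
      exact ⟨w, hw, hwz, fun h => absurd h h0⟩
  choose w hw hwz hw0 using hex
  obtain ⟨y, hy⟩ := exists_strand_eq m w hw
    ((finite_strand_ne_zero m z).subset fun b hb h => hb (hw0 b h))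
  exact ⟨y, strand_ext m fun b => by rw [strand_boundary, hy, hwz]⟩

end MonomialResolution

open MonomialResolution in
theorem theoremt {k : Type*} [Field k] {n t : ℕ}
    (I : Ideal (MvPolynomial (Fin n) k)) (m : Fin t → (Fin n →₀ ℕ))
    (hI : IsMinimallyGeneratedBy I m)
    (Δ : PreAbstractSimplicialComplex (Fin t)) [LinearOrder (MinNonface Δ)]
    (ω : MinNonface Δ → Fin t)
    (hω_notMem : ∀ σ, ω σ ∉ σ.verts)
    (hω_dvd : ∀ σ, MvPolynomial.monomial (m (ω σ)) (1 : k) ∣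
      MvPolynomial.monomial (label m σ.verts) (1 : k))
    (hω_class : ∀ σ, ∀ τ ∈ nonfaceClass σ, insert (ω σ) τ ∈ nonfaceClass σ) :
    SupportsFreeResolution m Δ I := by
  have hω_le : ∀ σ, m (ω σ) ≤ label m σ.verts := fun σ =>
    monomial_dvd_monomial_one_iff.1 (hω_dvd σ)
  refine ⟨fun i => ⟨inferInstance, inferInstance⟩, ⟨t, fun i hi => ?_⟩, ?_,
    fun z => ⟨fun hz => ?_, ?_⟩, fun i z => ⟨fun hz => ?_, ?_⟩⟩
  · have : IsEmpty (Face Δ i) := ⟨fun σ => by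
      have := σ.1.card_le_univ
      rw [σ.2.2, Fintype.card_fin] at this
      omega⟩
    infer_instance
  · rw [hI.1, range_augmentation m
      (singleton_mem_of_isMinimallyGeneratedBy hI ω hω_notMem hω_dvd)]
  · exact exact_of_strand m ω hω_notMem hω_le hω_class z fun b => by
      rw [simplexBoundary_strand_zero, hz]; simp
  · rintro ⟨y, rfl⟩
    ext b
    have := congrFun (simplexBoundary_strand_zero m b (boundary k m Δ 0 y)) ∅
    rw [strand_boundary, simplexBoundary_simplexBoundary, Pi.single_eq_same] at this
    rw [← this]; simp
  · exact exact_of_strand m ω hω_notMem hω_le hω_class z fun b => by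
      rw [← strand_boundary, hz, map_zero]
  · rintro ⟨y, rfl⟩
    refine strand_ext m fun b => ?_
    rw [strand_boundary, strand_boundary, simplexBoundary_simplexBoundary, map_zero]
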